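/- Let $n\ge 1$ and let $\tau>0$, $\alpha$ be real. For a partition $\lambda=(\lambda_1\ge\dots\ge\lambda_n\ge 0)$ and a box $s=(i,j)$ of its Young diagram write $a_\lambda(s)=\lambda_i-j$, $l_\lambda(s)=\#\{k>i:\lambda_k\ge j\}$, $a'(s)=j-1$, $l'(s)=i-1$ and $b_\lambda(s)=\frac{\tau l_\lambda(s)+a_\lambda(s)+\tau}{\tau l_\lambda(s)+a_\lambda(s)+1}$, and for $\mu\subseteq\lambda$ put $\psi_{\lambda\setminus\mu}=\prod_s b_\mu(s)/b_\lambda(s)$, the product over the boxes $s$ of $\mu$ with $a_\lambda(s)>a_\mu(s)$ and $l_\lambda(s)=l_\mu(s)$. A reverse tableau $T$ of shape $\lambda$ is a filling of the boxes by $1,\dots,n$, strictly decreasing down columns and weakly decreasing along rows; put $\lambda^{(i)}=\{s: T(s)>i\}$ and $\psi_T=\prod_{i=1}^n\psi_{\lambda^{(i-1)}\setminus\lambda^{(i)}}$. The Okounkov polynomial is $$P_\lambda(x;\tau,\alpha)=\sum_T\psi_T\prod_{s\in\lambda}\Big[x_{T(s)}^2-\big(a'(s)+\tau(n-T(s)-l'(s))+\alpha\big)^2\Big],$$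 the sum over all reverse tableaux of shape $\lambda$, and $q_\lambda=(-1)^{|\lambda|}P_\lambda$. Consider the rank-two Hermitian symmetric domains ($n=2$) of type $I_{2,2+b}$, $b\in\mathbb Z_{\ge 0}$ (the pair $(\mathfrak u(b+2,2),\mathfrak u(b+2)+\mathfrak u(2))$), with restricted root multiplicities $d=2$ (medium roots) and $2b$ (short roots), and of type $II_2$ (the pair $(\mathfrak{sp}(2,\mathbb R),\mathfrak u(2))$), with $d=1$ and $b=0$. Put $\tau=d/2$, $\alpha=(b+1)/2$, $\rho_1=\tau+\alpha$, $\rho_2=\alpha$, and let $\mathcal C=\{x\in\mathbb R^2: x_1\ge x_2\ge 0\}$, $$\mathcal A_0=\{x\in\mathcal C: q_\lambda(x)\ge 0\text{ for all partitions }\lambda=(\lambda_1\ge\lambda_2\ge 0)\},$$ $$R(x)=\sum_{k=0}^\infty\frac{(\rho_2+x_2)_k(\rho_2-x_2)_k(\tfrac d2)_k}{(\rho_1+x_1)_k(\rho_1-x_1)_k\,k!},\qquad \mathcal B=\{x\in\mathcal C: q_{(1,0)}(x)\ge 0,\ q_{(1,1)}(x)\ge 0,\ R(x)\ge 0\},$$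 where $(a)_k=a(a+1)\cdots(a+k-1)$ and terms with vanishing numerator are read as $0$ (this matters only at $x=(\rho_1,\rho_2)$, where thus $R(x)=1$). Then the series $R(x)$ converges at every $x\in\mathcal C$ with $q_{(1,0)}(x)\ge 0$ and $q_{(1,1)}(x)\ge 0$; for type $I_{2,2+b}$ one has $\mathcal A_0=\mathcal B$; and for type $II_2$ one has $\mathcal A_0\subseteq\mathcal B$. -/

import Mathlib

namespace Shimura

/-- `lam = (lam 0 ≥ lam 1 ≥ ⋯ ≥ lam (n-1) ≥ 0)` is a partition with at most `n` parts.
Rows and columns are numbered from `0` throughout, so the row `i` and column `j` of this file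
are the row `i + 1` and column `j + 1` of the usual numbering. -/
def IsPartition {n : ℕ} (lam : Fin n → ℕ) : Prop := Antitone lam

/-- The boxes of the Young diagram of `lam`. -/
abbrev Box {n : ℕ} (lam : Fin n → ℕ) : Type := (i : Fin n) × Fin (lam i)

/-- Arm length of the box in row `i`, column `j` (used for boxes of `lam` only). -/
def arm {n : ℕ} (lam : Fin n → ℕ) (i : Fin n) (j : ℕ) : ℕ := lam i - (j + 1)

/-- Leg length: the number of rows below row `i` that reach column `j`. -/
def leg {n : ℕ} (lam : Fin n → ℕ) (i : Fin n) (j : ℕ) : ℕ :=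
  (Finset.univ.filter fun k : Fin n => i < k ∧ j < lam k).card

/-- `b_lam(s) = (τ l(s) + a(s) + τ) / (τ l(s) + a(s) + 1)`. -/
noncomputable def boxWeight (τ : ℝ) {n : ℕ} (lam : Fin n → ℕ) (i : Fin n) (j : ℕ) : ℝ :=
  (τ * (leg lam i j : ℝ) + (arm lam i j : ℝ) + τ) / (τ * (leg lam i j : ℝ) + (arm lam i j : ℝ) + 1)

/-- `ψ_{lam \ mu}`: the product of `b_mu(s) / b_lam(s)` over the boxes `s` of `mu` with
`a_lam(s) > a_mu(s)` and `l_lam(s) = l_mu(s)`. -/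
noncomputable def skewWeight (τ : ℝ) {n : ℕ} (lam mu : Fin n → ℕ) : ℝ :=
  ∏ s ∈ Finset.univ.filter (fun s : Box mu =>
      arm mu s.1 s.2 < arm lam s.1 s.2 ∧ leg lam s.1 s.2 = leg mu s.1 s.2),
    boxWeight τ mu s.1 s.2 / boxWeight τ lam s.1 s.2

/-- A reverse tableau of shape `lam`: a filling of the boxes, strictly decreasing down the columns
and weakly decreasing along the rows. The entry `T s : Fin n` stands for the number `T s + 1`
of `{1, …, n}`. -/
structure IsReverseTableau {n : ℕ} {lam : Fin n → ℕ} (T : Box lam → Fin n) : Prop where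
  col : ∀ s t : Box lam, s.1 < t.1 → (s.2 : ℕ) = (t.2 : ℕ) → T t < T s
  row : ∀ s t : Box lam, s.1 = t.1 → (s.2 : ℕ) ≤ (t.2 : ℕ) → T t ≤ T s

/-- The partition `lam⁽ⁱ⁾` of the boxes whose number `T s + 1` exceeds `i`, given by its row
lengths. -/
def layer {n : ℕ} {lam : Fin n → ℕ} (T : Box lam → Fin n) (i : ℕ) : Fin n → ℕ := fun r =>
  (Finset.univ.filter fun j : Fin (lam r) => i < (T ⟨r, j⟩ : ℕ) + 1).card

/-- `ψ_T`, the product of the weights of the successive layers `lam⁽ⁱ⁾ ⊇ lam⁽ⁱ⁺¹⁾`. -/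
noncomputable def tableauWeight (τ : ℝ) {n : ℕ} {lam : Fin n → ℕ} (T : Box lam → Fin n) : ℝ :=
  ∏ i ∈ Finset.range n, skewWeight τ (layer T i) (layer T (i + 1))

open Classical in
/-- The Okounkov (`BC_n` interpolation) polynomial `P_lam(x; τ, α)`: the sum over the reverse
tableaux `T` of `ψ_T ∏_s (x_{T(s)}² - (a'(s) + τ (n - T(s) - l'(s)) + α)²)`. -/
noncomputable def okounkov {n : ℕ} (τ α : ℝ) (lam : Fin n → ℕ) (x : Fin n → ℝ) : ℝ :=
  ∑ T ∈ Finset.univ.filter (fun T : Box lam → Fin n => IsReverseTableau T),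
    tableauWeight τ T * ∏ s : Box lam,
      (x (T s) ^ 2 -
        (((s.2 : ℕ) : ℝ) + τ * ((n : ℝ) - (((T s : ℕ) : ℝ) + 1) - ((s.1 : ℕ) : ℝ)) + α) ^ 2)

/-- The signed polynomial `q_lam = (-1)^{|lam|} P_lam`. -/
noncomputable def signedOkounkov {n : ℕ} (τ α : ℝ) (lam : Fin n → ℕ) (x : Fin n → ℝ) : ℝ :=
  (-1) ^ (∑ i, lam i) * okounkov τ α lam x

/-- The Weyl chamber `x_1 ≥ ⋯ ≥ x_n ≥ 0`. -/
def chamber (n : ℕ) : Set (Fin n → ℝ) := {x | Antitone x ∧ ∀ i, 0 ≤ x i}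

/-- The `k`-th term `(a_1)_k ⋯ (a_p)_k / ((b_1)_k ⋯ (b_q)_k k!)` of the hypergeometric series
`_pF_q(a; b; 1)`. -/
noncomputable def hypergeometricTerm (a b : List ℝ) (k : ℕ) : ℝ :=
  (a.map fun c => (ascPochhammer ℝ k).eval c).prod /
    (b.map fun c => (ascPochhammer ℝ k).eval c).prod / (k.factorial : ℝ)

/-- The rank two Hermitian symmetric domains considered here: type `I_{2,2+b}`, for the pair
`(𝔲(b+2,2), 𝔲(b+2) + 𝔲(2))`, and type `II_2`, for the pair `(𝔰𝔭(2,ℝ), 𝔲(2))`. -/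
inductive RankTwoDomain : Type
  | typeI (b : ℕ)
  | typeII

namespace RankTwoDomain

/-- The multiplicity `d` of the medium restricted roots `±ε₁ ± ε₂`. -/
def d : RankTwoDomain → ℕ
  | typeI _ => 2
  | typeII => 1

/-- Half the multiplicity `2b` of the short restricted roots `±ε₁, ±ε₂`. -/
def b : RankTwoDomain → ℕ
  | typeI b => b
  | typeII => 0

/-- `τ = d / 2`. -/
noncomputable def tau (D : RankTwoDomain) : ℝ := (D.d : ℝ) / 2

/-- `α = (b + 1) / 2`. -/
noncomputable def alpha (D : RankTwoDomain) : ℝ := ((D.b : ℝ) + 1) / 2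

/-- `ρ₁ = τ + α`. -/
noncomputable def rho1 (D : RankTwoDomain) : ℝ := D.tau + D.alpha

/-- `ρ₂ = α`. -/
noncomputable def rho2 (D : RankTwoDomain) : ℝ := D.alpha

/-- The polynomial `q_lam` of the domain. -/
noncomputable def q (D : RankTwoDomain) (lam : Fin 2 → ℕ) (x : Fin 2 → ℝ) : ℝ :=
  signedOkounkov D.tau D.alpha lam x

/-- The set `𝒜₀` of the points of the Weyl chamber at which all the `q_lam` are nonnegative. -/
def A0 (D : RankTwoDomain) : Set (Fin 2 → ℝ) :=
  {x | x ∈ chamber 2 ∧ ∀ lam : Fin 2 → ℕ, IsPartition lam → 0 ≤ D.q lam x}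

/-- The terms of the series `R`. On the points of the chamber with `q_{1,0}, q_{1,1} ≥ 0` the
denominators are nonzero, except at `x = ρ`, where the numerators vanish for `k ≥ 1`; as usual for
terminating series these terms are `0`. -/
noncomputable def rTerm (D : RankTwoDomain) (x : Fin 2 → ℝ) : ℕ → ℝ :=
  hypergeometricTerm [D.rho2 + x 1, D.rho2 - x 1, (D.d : ℝ) / 2] [D.rho1 + x 0, D.rho1 - x 0]

/-- `R(x) = ₃F₂(ρ₂ + x₂, ρ₂ - x₂, d/2; ρ₁ + x₁, ρ₁ - x₁; 1)`. -/
noncomputable def R (D : RankTwoDomain) (x : Fin 2 → ℝ) : ℝ := ∑' k, D.rTerm x k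

/-- `ℬ`, cut out by three inequalities. -/
def B (D : RankTwoDomain) : Set (Fin 2 → ℝ) :=
  {x | x ∈ chamber 2 ∧ 0 ≤ D.q ![1, 0] x ∧ 0 ≤ D.q ![1, 1] x ∧ 0 ≤ D.R x}

end RankTwoDomain

end Shimura

/-
A reverse tableau of shape `(l + m, l)` is determined by the number of `2`s in its first row, and
its weight is `β_i β_{m-i} / β_m` with `β_k = (τ)_k / k!`. Hence `q_{(m,0)}` is a positive multiple
of `∑ i ≤ m, (β_{m-i} / β_m) r_i`, where `r_i` are the terms of `R`. If `x_2 > ρ_2`, then `r_i ≤ 0`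
for `i ≥ 1`, while for `τ ≤ 1` the coefficients are at least `1`, with equality at `i = 0`; so
`q_{(m,0)}(x) ≥ 0` for all `m` makes all partial sums of `R`, and with them `R`, nonnegative. For
`τ = 1` the coefficients are all `1`, so `q_{(m,0)}` is a positive multiple of a partial sum of `R`,
which is at least `R`. In all other cases every factor involved has a known sign. The series
converges by Gauss's test, its parametric excess being `τ`.
-/

namespace Shimura

open Finset Filter
open scoped Topology

theorem summable_of_le_sub {a u : ℕ → ℝ} (ha : ∀ n, 0 ≤ a n) (hu : ∀ n, 0 ≤ u n)
    (h : ∀ n, a n ≤ u n - u (n + 1)) : Summable a :=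
  summable_of_sum_range_le (c := u 0) ha fun n => by
    calc ∑ k ∈ range n, a k ≤ ∑ k ∈ range n, (u k - u (k + 1)) := sum_le_sum fun k _ => h k
      _ = u 0 - u n := sum_range_sub' u n
      _ ≤ u 0 := sub_le_self _ (hu n)

theorem summable_of_tendsto_raabe {E : Type*} [NormedAddCommGroup E] [CompleteSpace E]
    {f : ℕ → E} {r : ℕ → ℝ} {L : ℝ} (hL : 1 < L)
    (hr : Tendsto (fun k : ℕ => (k : ℝ) * (r k - 1)) atTop (𝓝 L))
    (hf : ∀ᶠ k in atTop, r k * ‖f (k + 1)‖ ≤ ‖f k‖) : Summable f := by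
  obtain ⟨c, hc, hcL⟩ := exists_between hL
  obtain ⟨K, hK⟩ := eventually_atTop.1 ((hr.eventually_const_lt hcL).and hf)
  have telescoping : ∀ k ≥ K,
      (c - 1) * ‖f (k + 1)‖ ≤ k * ‖f k‖ - (k + 1 : ℕ) * ‖f (k + 1)‖ := by
    intro k hk
    obtain ⟨hcr, hfk⟩ := hK k hk
    have lower : (k + c) * ‖f (k + 1)‖ ≤ k * r k * ‖f (k + 1)‖ := by
      gcongr
      linarith
    have upper : k * (r k * ‖f (k + 1)‖) ≤ k * ‖f k‖ := by gcongr
    push_cast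
    linarith
  have hsum : Summable fun n : ℕ => (c - 1) * ‖f (n + (K + 1))‖ := by
    refine summable_of_le_sub (u := fun n => ((n + K : ℕ) : ℝ) * ‖f (n + K)‖)
      (fun n => mul_nonneg (sub_nonneg.2 hc.le) (norm_nonneg _)) (fun n => by positivity)
      fun n => ?_
    rw [add_right_comm n 1 K, ← add_assoc]
    exact telescoping (n + K) (Nat.le_add_left K n)
  have hnorm := (summable_mul_left_iff (sub_pos.2 hc).ne').1 hsum
  exact ((summable_nat_add_iff (f := fun n => ‖f n‖) (K + 1)).1 hnorm).of_norm

theorem tendsto_one_of_tendsto_mul_sub_one {u : ℕ → ℝ} {s : ℝ}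
    (h : Tendsto (fun k : ℕ => (k : ℝ) * (u k - 1)) atTop (𝓝 s)) : Tendsto u atTop (𝓝 1) := by
  have hlim : Tendsto (fun k : ℕ => (k : ℝ) * (u k - 1) / k + 1) atTop (𝓝 1) := by
    simpa only [zero_add] using (h.div_atTop tendsto_natCast_atTop_atTop).add_const 1
  refine hlim.congr' ?_
  filter_upwards [eventually_ne_atTop 0] with k hk
  have hk' : (k : ℝ) ≠ 0 := Nat.cast_ne_zero.2 hk
  rw [mul_div_cancel_left₀ _ hk', sub_add_cancel]

theorem tendsto_mul_prod_one_add_div_sub_one (l : List ℝ) :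
    Tendsto (fun k : ℕ => (k : ℝ) * ((l.map fun c => 1 + c / (k : ℝ)).prod - 1)) atTop
      (𝓝 l.sum) := by
  induction l with
  | nil => simp
  | cons c l ih =>
    have hlim := ((tendsto_one_of_tendsto_mul_sub_one ih).const_mul c).add ih
    rw [mul_one] at hlim
    rw [List.sum_cons]
    refine hlim.congr' ?_
    filter_upwards [eventually_ne_atTop 0] with k hk
    have hk' : (k : ℝ) ≠ 0 := Nat.cast_ne_zero.2 hk
    rw [List.map_cons, List.prod_cons]
    field_simp
    ring

theorem prod_map_add_natCast {K : Type*} [Field K] [CharZero K] (l : List K) {k : ℕ} (hk : k ≠ 0) :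
    (l.map fun c => c + (k : K)).prod =
      (k : K) ^ l.length * (l.map fun c => 1 + c / (k : K)).prod := by
  have hk' : (k : K) ≠ 0 := Nat.cast_ne_zero.2 hk
  induction l with
  | nil => simp
  | cons c l ih =>
    simp only [List.map_cons, List.prod_cons, ih, List.length_cons]
    field_simp
    ring

theorem hypergeometricTerm_succ (a b : List ℝ) (k : ℕ) :
    hypergeometricTerm a b (k + 1) = hypergeometricTerm a b k *
      ((a.map fun c => c + (k : ℝ)).prod / ((1 :: b).map fun c => c + (k : ℝ)).prod) := by
  simp only [hypergeometricTerm, ascPochhammer_succ_eval, List.prod_map_mul, Nat.factorial_succ,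
    List.map_cons, List.prod_cons, Nat.cast_mul, Nat.cast_succ, div_eq_mul_inv, mul_inv]
  ring

/- Gauss: writing `u k`, `v k` for the two products of factors `1 + c / k`, successive terms have
ratio `u k / v k`, and `k (v k / u k - 1)` tends to `1 + ∑ b - ∑ a`. -/
theorem summable_hypergeometricTerm {a b : List ℝ} (hlen : a.length = b.length + 1)
    (hsum : a.sum < b.sum) : Summable (hypergeometricTerm a b) := by
  set u : ℕ → ℝ := fun k => (a.map fun c => 1 + c / (k : ℝ)).prod
  set v : ℕ → ℝ := fun k => ((1 :: b).map fun c => 1 + c / (k : ℝ)).prod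
  have hu : Tendsto (fun k : ℕ => (k : ℝ) * (u k - 1)) atTop (𝓝 a.sum) :=
    tendsto_mul_prod_one_add_div_sub_one a
  have hv : Tendsto (fun k : ℕ => (k : ℝ) * (v k - 1)) atTop (𝓝 (1 :: b).sum) :=
    tendsto_mul_prod_one_add_div_sub_one (1 :: b)
  have hu1 := tendsto_one_of_tendsto_mul_sub_one hu
  have hv1 := tendsto_one_of_tendsto_mul_sub_one hv
  have hupos : ∀ᶠ k in atTop, 0 < u k := hu1.eventually_const_lt one_pos
  have hvpos : ∀ᶠ k in atTop, 0 < v k := hv1.eventually_const_lt one_pos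
  refine summable_of_tendsto_raabe (r := fun k => v k / u k) (L := 1 + b.sum - a.sum)
    (by linarith) ?_ ?_
  · have hlim := (hv.sub hu).div hu1 one_ne_zero
    rw [div_one, List.sum_cons] at hlim
    refine hlim.congr' ?_
    filter_upwards [hupos] with k hk
    have := hk.ne'
    rw [Pi.div_apply]
    field_simp
    ring
  · filter_upwards [hupos, hvpos, eventually_ne_atTop 0] with k huk hvk hk
    have hratio : hypergeometricTerm a b (k + 1) = hypergeometricTerm a b k * (u k / v k) := by
      rw [hypergeometricTerm_succ, prod_map_add_natCast _ hk, prod_map_add_natCast _ hk, hlen,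
        List.length_cons, mul_div_mul_left _ _ (pow_ne_zero _ (Nat.cast_ne_zero.2 hk))]
    rw [hratio, norm_mul, Real.norm_of_nonneg (div_pos huk hvk).le]
    field_simp
    exact le_rfl

/-- The product `(c + y)_k (c - y)_k` of rising factorials, an even polynomial in `y`. All linear
factors of the Okounkov polynomials and of the series `R` occur in such products. -/
noncomputable def pochhammerPair {R : Type*} [CommRing R] (c y : R) (k : ℕ) : R :=
  (ascPochhammer R k).eval (c + y) * (ascPochhammer R k).eval (c - y)

section PochhammerPair

variable {R : Type*} [CommRing R] (c y : R)

theorem pochhammerPair_zero : pochhammerPair c y 0 = 1 := by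
  simp [pochhammerPair]

theorem pochhammerPair_succ (k : ℕ) :
    pochhammerPair c y (k + 1) = pochhammerPair c y k * ((k + c) ^ 2 - y ^ 2) := by
  simp only [pochhammerPair, ascPochhammer_succ_eval]
  ring

theorem pochhammerPair_eq_prod (k : ℕ) :
    pochhammerPair c y k = ∏ j ∈ range k, ((j + c) ^ 2 - y ^ 2) := by
  induction k with
  | zero => simp [pochhammerPair_zero]
  | succ k ih => rw [pochhammerPair_succ, ih, prod_range_succ]

theorem pochhammerPair_one : pochhammerPair c y 1 = c ^ 2 - y ^ 2 := by
  simp [pochhammerPair_eq_prod]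

theorem pochhammerPair_add (k m : ℕ) :
    pochhammerPair c y (k + m) = pochhammerPair c y k * pochhammerPair (c + k) y m := by
  simp only [pochhammerPair_eq_prod, prod_range_add]
  congr! 3 with j
  push_cast
  ring

theorem pochhammerPair_succ' (k : ℕ) :
    pochhammerPair c y (k + 1) = (c ^ 2 - y ^ 2) * pochhammerPair (c + 1) y k := by
  rw [add_comm k, pochhammerPair_add, pochhammerPair_one, Nat.cast_one]

variable {c y} [LinearOrder R] [IsStrictOrderedRing R]

theorem pochhammerPair_pos (h : |y| < c) (k : ℕ) : 0 < pochhammerPair c y k := by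
  obtain ⟨hneg, hpos⟩ := abs_lt.1 h
  exact mul_pos (ascPochhammer_pos k _ (by linarith)) (ascPochhammer_pos k _ (by linarith))

theorem pochhammerPair_nonneg (h : |y| ≤ c) (k : ℕ) : 0 ≤ pochhammerPair c y k := by
  rw [pochhammerPair_eq_prod]
  refine prod_nonneg fun j _ => sub_nonneg.2 (sq_le_sq' ?_ ?_) <;>
    linarith [abs_le.1 h, Nat.cast_nonneg (α := R) j]

theorem pochhammerPair_succ_nonpos (hcy : |c| ≤ |y|) (hyc : |y| ≤ c + 1) (k : ℕ) :
    pochhammerPair c y (k + 1) ≤ 0 := by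
  rw [pochhammerPair_succ']
  exact mul_nonpos_of_nonpos_of_nonneg (sub_nonpos.2 (sq_le_sq.2 hcy))
    (pochhammerPair_nonneg hyc k)

end PochhammerPair

section Multichoose

variable {K : Type*} [Field K] [CharZero K]

theorem multichoose_eq_ascPochhammer_eval_div (τ : K) (k : ℕ) :
    Ring.multichoose τ k = (ascPochhammer K k).eval τ / k.factorial := by
  rw [eq_div_iff (Nat.cast_ne_zero.2 k.factorial_ne_zero), mul_comm, ← nsmul_eq_mul,
    Ring.factorial_nsmul_multichoose_eq_ascPochhammer, Polynomial.ascPochhammer_smeval_eq_eval]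

theorem multichoose_succ (τ : K) (k : ℕ) :
    Ring.multichoose τ (k + 1) = Ring.multichoose τ k * ((k + τ) / (k + 1)) := by
  rw [multichoose_eq_ascPochhammer_eval_div, multichoose_eq_ascPochhammer_eval_div,
    ascPochhammer_succ_eval, Nat.factorial_succ, Nat.cast_mul, Nat.cast_succ, add_comm τ,
    mul_comm (k + 1 : K), mul_div_mul_comm]

theorem multichoose_eq_prod (τ : K) (k : ℕ) :
    Ring.multichoose τ k = ∏ j ∈ range k, (j + τ) / (j + 1) := by
  induction k with
  | zero => simp
  | succ k ih => rw [multichoose_succ, ih, prod_range_succ]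

end Multichoose

section MultichooseOrdered

variable {K : Type*} [Field K] [LinearOrder K] [IsStrictOrderedRing K] {τ : K}

theorem multichoose_pos (hτ : 0 < τ) (k : ℕ) : 0 < Ring.multichoose τ k := by
  rw [multichoose_eq_ascPochhammer_eval_div]
  exact div_pos (ascPochhammer_pos k τ hτ) (by positivity)

theorem antitone_multichoose (hτ : 0 < τ) (hτ1 : τ ≤ 1) : Antitone (Ring.multichoose τ) := by
  refine antitone_nat_of_succ_le fun k => ?_
  rw [multichoose_succ]
  exact mul_le_of_le_one_right (multichoose_pos hτ k).le
    ((div_le_one (by positivity)).2 (by gcongr))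

end MultichooseOrdered

section Tableaux

variable {n : ℕ} {lam : Fin n → ℕ}

theorem layer_zero (T : Box lam → Fin n) : layer T 0 = lam := by
  funext r
  simp [layer]

theorem layer_self (T : Box lam → Fin n) : layer T n = 0 := by
  funext r
  simp only [layer, Pi.zero_apply, card_eq_zero, filter_eq_empty_iff]
  intro j _
  omega

theorem skewWeight_zero_right (τ : ℝ) (lam : Fin n → ℕ) : skewWeight τ lam 0 = 1 :=
  prod_eq_one fun s _ => s.2.elim0

/-- The factor `(a'(s) + τ (n - T(s) - l'(s)) + α)² - x_{T(s)}²` contributed by the box `s` of a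
tableau `T` to the polynomial `q_lam`, with the sign opposite to that in `okounkov`. -/
def boxFactor (τ α : ℝ) (x : Fin n → ℝ) (T : Box lam → Fin n) (s : Box lam) : ℝ :=
  (((s.2 : ℕ) : ℝ) + τ * ((n : ℝ) - (((T s : ℕ) : ℝ) + 1) - ((s.1 : ℕ) : ℝ)) + α) ^ 2 - x (T s) ^ 2

theorem signedOkounkov_eq_sum (τ α : ℝ) (lam : Fin n → ℕ) (x : Fin n → ℝ)
    [DecidablePred fun T : Box lam → Fin n => IsReverseTableau T] :
    signedOkounkov τ α lam x =
      ∑ T : Box lam → Fin n with IsReverseTableau T,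
        tableauWeight τ T * ∏ s, boxFactor τ α x T s := by
  have hcard : ∑ i, lam i = #(univ : Finset (Box lam)) := by simp
  rw [signedOkounkov, okounkov, mul_sum]
  refine sum_congr (by congr) fun T _ => ?_
  rw [mul_left_comm, hcard, ← prod_neg]
  simp only [neg_sub, boxFactor]

end Tableaux

section TwoRows

/-- The reverse tableau of shape `(l + m, l)` whose first row has `l + i` entries equal to `2` (that
is, to `1 : Fin 2`), all other entries being `1`. -/
def twoRowTableau (l m i : ℕ) (s : Box ![l + m, l]) : Fin 2 :=
  if s.1 = 0 ∧ (s.2 : ℕ) < l + i then 1 else 0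

theorem twoRowTableau_zero (l m i : ℕ) (j : Fin (l + m)) :
    twoRowTableau l m i ⟨0, j⟩ = if (j : ℕ) < l + i then 1 else 0 := by
  simp [twoRowTableau]

theorem twoRowTableau_one (l m i : ℕ) (j : Fin l) : twoRowTableau l m i ⟨1, j⟩ = 0 := by
  simp [twoRowTableau]

theorem isReverseTableau_twoRowTableau (l m i : ℕ) : IsReverseTableau (twoRowTableau l m i) where
  col := by
    rintro ⟨s, j⟩ ⟨t, k⟩ hst hjk
    have eq_of_lt : ∀ s t : Fin 2, s < t → s = 0 ∧ t = 1 := by decide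
    obtain ⟨rfl, rfl⟩ := eq_of_lt s t hst
    have hj : (j : ℕ) < l + i := by
      change (j : ℕ) = k at hjk
      have : (k : ℕ) < l := k.2
      omega
    rw [twoRowTableau_one l m i k, twoRowTableau_zero l m i j, if_pos hj]
    exact zero_lt_one
  row := by
    rintro ⟨s, j⟩ ⟨t, k⟩ hst hjk
    obtain rfl : s = t := hst
    change (j : ℕ) ≤ k at hjk
    simp only [twoRowTableau]
    split_ifs with hk hj
    · exact le_rfl
    · exact absurd ⟨hk.1, hjk.trans_lt hk.2⟩ hj
    · exact Fin.zero_le _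
    · exact le_rfl

theorem twoRowTableau_injOn (l m : ℕ) : Set.InjOn (twoRowTableau l m) (Set.Iic m) := by
  have ne_of_lt : ∀ {i k : ℕ}, i < k → k ≤ m → twoRowTableau l m i ≠ twoRowTableau l m k := by
    intro i k hik hk heq
    have hbox := congrFun heq ⟨0, (⟨l + i, by omega⟩ : Fin (l + m))⟩
    rw [twoRowTableau_zero, twoRowTableau_zero, if_neg (lt_irrefl _),
      if_pos (Nat.add_lt_add_left hik l)] at hbox
    exact zero_ne_one hbox
  intro i hi k hk heq
  by_contra hne
  rcases lt_or_gt_of_ne hne with hik | hki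
  · exact ne_of_lt hik hk heq
  · exact ne_of_lt hki hi heq.symm

theorem exists_forall_eq_ite_of_antitone {N : ℕ} {f : Fin N → Fin 2} (hf : Antitone f) :
    ∃ c ≤ N, ∀ j : Fin N, f j = if (j : ℕ) < c then 1 else 0 := by
  have hex : ∃ c : ℕ, ∀ j : Fin N, c ≤ j → f j = 0 := ⟨N, fun j hj => absurd j.2 hj.not_gt⟩
  refine ⟨Nat.find hex, Nat.find_min' hex fun j hj => absurd j.2 hj.not_gt, fun j => ?_⟩
  split_ifs with hj
  · by_contra hne
    have hzero : f j = 0 := by omega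
    exact hj.not_ge (Nat.find_min' hex fun k hk => by have := hf (a := j) (b := k) hk; omega)
  · exact Nat.find_spec hex j (not_lt.1 hj)

theorem IsReverseTableau.exists_eq_twoRowTableau {l m : ℕ} {T : Box ![l + m, l] → Fin 2}
    (hT : IsReverseTableau T) : ∃ i ≤ m, T = twoRowTableau l m i := by
  have column (j : Fin l) : T ⟨1, j⟩ < T ⟨0, Fin.castAdd m j⟩ :=
    hT.col ⟨0, Fin.castAdd m j⟩ ⟨1, j⟩ zero_lt_one rfl
  obtain ⟨c, hc, hrow⟩ := exists_forall_eq_ite_of_antitone (f := fun j : Fin (l + m) => T ⟨0, j⟩)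
    fun j k hjk => hT.row ⟨0, j⟩ ⟨0, k⟩ rfl hjk
  have hlc : l ≤ c := by
    by_contra! hcl
    have hcol := column ⟨c, hcl⟩
    rw [show T ⟨0, Fin.castAdd m ⟨c, hcl⟩⟩ = 0 from (hrow _).trans (if_neg (lt_irrefl c))] at hcol
    exact Fin.not_lt_zero _ hcol
  obtain ⟨i, rfl⟩ := Nat.exists_eq_add_of_le hlc
  refine ⟨i, by omega, ?_⟩
  funext ⟨s, j⟩
  match s, j with
  | 0, j => exact (hrow j).trans (twoRowTableau_zero l m i j).symm
  | 1, j =>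
    rw [twoRowTableau_one l m i j]
    have hlt : T ⟨1, j⟩ < T ⟨0, Fin.castAdd m j⟩ := column j
    omega

theorem layer_twoRowTableau_one {l m i : ℕ} (hi : i ≤ m) :
    layer (twoRowTableau l m i) 1 = ![l + i, 0] := by
  have hrow (j : Fin (l + m)) :
      1 < (twoRowTableau l m i ⟨0, j⟩ : ℕ) + 1 ↔ (j : ℕ) < l + i := by
    rw [twoRowTableau_zero]
    split_ifs with h <;> simp [h]
  funext r
  match r with
  | 0 =>
    calc layer (twoRowTableau l m i) 1 0 = #{j : Fin (l + m) | (j : ℕ) < l + i} :=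
          congrArg card (filter_congr fun j _ => hrow j)
      _ = l + i := by rw [Fin.card_filter_val_lt, min_eq_right (by omega)]
  | 1 => exact card_eq_zero.2 (filter_eq_empty_iff.2 fun j _ => by
      rw [twoRowTableau_one l m i j]
      exact lt_irrefl 1)

theorem leg_pair_zero (a b j : ℕ) : leg ![a, b] 0 j = if j < b then 1 else 0 := by
  split_ifs with hj
  · exact card_eq_one.2 ⟨1, by ext r; fin_cases r <;> simp [hj]⟩
  · exact card_eq_zero.2 (by ext r; fin_cases r <;> simp [hj])

theorem boxWeight_of_leg_eq_zero (τ : ℝ) {n : ℕ} {lam : Fin n → ℕ} {i : Fin n} {j : ℕ}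
    (h : leg lam i j = 0) : boxWeight τ lam i j = (arm lam i j + τ) / (arm lam i j + 1) := by
  simp only [boxWeight, h, Nat.cast_zero, mul_zero, zero_add]

theorem skewWeight_two_rows_eq_prod {τ : ℝ} (hτ : 0 < τ) (l i k : ℕ) :
    skewWeight τ ![l + (i + k), l] ![l + i, 0] =
      ∏ j ∈ range i, ((j + τ) / (j + 1)) / (((k + j : ℕ) + τ) / ((k + j : ℕ) + 1)) := by
  rw [skewWeight, prod_filter, Fintype.prod_sigma, Fin.prod_univ_two]
  change (∏ j : Fin (l + i), _) * (∏ j : Fin 0, _) = _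
  rw [Fin.prod_univ_zero, mul_one, Fin.prod_univ_eq_prod_range (fun j : ℕ =>
    if arm ![l + i, 0] 0 j < arm ![l + (i + k), l] 0 j ∧
        leg ![l + (i + k), l] 0 j = leg ![l + i, 0] 0 j then
      boxWeight τ ![l + i, 0] 0 j / boxWeight τ ![l + (i + k), l] 0 j else 1) (l + i),
    prod_range_add, prod_eq_one, one_mul, ← prod_range_reflect]
  · refine prod_congr rfl fun j hj => ?_
    have hji : j < i := mem_range.1 hj
    have leg_mu : leg ![l + i, 0] 0 (l + (i - 1 - j)) = 0 := by simp [leg_pair_zero]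
    have leg_lam : leg ![l + (i + k), l] 0 (l + (i - 1 - j)) = 0 := by simp [leg_pair_zero]
    have arm_mu : arm ![l + i, 0] 0 (l + (i - 1 - j)) = j := by
      simp only [arm, Matrix.cons_val_zero]
      omega
    have arm_lam : arm ![l + (i + k), l] 0 (l + (i - 1 - j)) = k + j := by
      simp only [arm, Matrix.cons_val_zero]
      omega
    rw [boxWeight_of_leg_eq_zero τ leg_mu, boxWeight_of_leg_eq_zero τ leg_lam, leg_mu, leg_lam,
      arm_mu, arm_lam]
    split_ifs with h
    · rfl
    · obtain rfl : k = 0 := by omega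
      rw [zero_add, div_self (by positivity)]
  · intro j hj
    simp [leg_pair_zero, mem_range.1 hj]

theorem skewWeight_two_rows {τ : ℝ} (hτ : 0 < τ) (l i k : ℕ) :
    skewWeight τ ![l + (i + k), l] ![l + i, 0] =
      Ring.multichoose τ i * Ring.multichoose τ k / Ring.multichoose τ (i + k) := by
  rw [skewWeight_two_rows_eq_prod hτ, prod_div_distrib, ← multichoose_eq_prod, add_comm i k,
    multichoose_eq_prod τ (k + i), prod_range_add, ← multichoose_eq_prod τ k, mul_comm,
    mul_div_mul_left _ _ (multichoose_pos hτ k).ne']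

theorem tableauWeight_twoRowTableau {τ : ℝ} (hτ : 0 < τ) (l i k : ℕ) :
    tableauWeight τ (twoRowTableau l (i + k) i) =
      Ring.multichoose τ i * Ring.multichoose τ k / Ring.multichoose τ (i + k) := by
  rw [tableauWeight, prod_range_succ, prod_range_one, layer_zero,
    layer_twoRowTableau_one (Nat.le_add_right i k), layer_self, skewWeight_zero_right, mul_one,
    skewWeight_two_rows hτ]

theorem boxFactor_twoRowTableau_zero (τ α : ℝ) (l m i : ℕ) (x : Fin 2 → ℝ) (j : Fin (l + m)) :
    boxFactor τ α x (twoRowTableau l m i) ⟨0, j⟩ =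
      if (j : ℕ) < l + i then ((j : ℕ) + α) ^ 2 - x 1 ^ 2
        else ((j : ℕ) + (τ + α)) ^ 2 - x 0 ^ 2 := by
  simp only [boxFactor, twoRowTableau_zero l m i j]
  split_ifs
  · norm_num
  · norm_num
    ring

theorem boxFactor_twoRowTableau_one (τ α : ℝ) (l m i : ℕ) (x : Fin 2 → ℝ) (j : Fin l) :
    boxFactor τ α x (twoRowTableau l m i) ⟨1, j⟩ = ((j : ℕ) + α) ^ 2 - x 0 ^ 2 := by
  simp only [boxFactor, twoRowTableau_one l m i j]
  norm_num

theorem prod_boxFactor_twoRowTableau (τ α : ℝ) (l i k : ℕ) (x : Fin 2 → ℝ) :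
    ∏ s, boxFactor τ α x (twoRowTableau l (i + k) i) s =
      pochhammerPair α (x 0) l * pochhammerPair α (x 1) l *
        (pochhammerPair (α + l) (x 1) i * pochhammerPair (τ + α + (l + i : ℕ)) (x 0) k) := by
  have upper_row : ∏ j : Fin (l + (i + k)), boxFactor τ α x (twoRowTableau l (i + k) i) ⟨0, j⟩ =
      pochhammerPair α (x 1) (l + i) * pochhammerPair (τ + α + (l + i : ℕ)) (x 0) k := by
    rw [prod_congr rfl fun j _ => boxFactor_twoRowTableau_zero τ α l (i + k) i x j,
      Fin.prod_univ_eq_prod_range (fun j : ℕ =>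
        if j < l + i then ((j : ℝ) + α) ^ 2 - x 1 ^ 2 else ((j : ℝ) + (τ + α)) ^ 2 - x 0 ^ 2),
      ← add_assoc, prod_range_add, pochhammerPair_eq_prod, pochhammerPair_eq_prod]
    congr 1
    · exact prod_congr rfl fun j hj => if_pos (mem_range.1 hj)
    · refine prod_congr rfl fun j _ => ?_
      rw [if_neg (by omega)]
      push_cast
      ring
  have lower_row : ∏ j : Fin l, boxFactor τ α x (twoRowTableau l (i + k) i) ⟨1, j⟩ =
      pochhammerPair α (x 0) l := by
    rw [prod_congr rfl fun j _ => boxFactor_twoRowTableau_one τ α l (i + k) i x j,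
      Fin.prod_univ_eq_prod_range (fun j : ℕ => ((j : ℝ) + α) ^ 2 - x 0 ^ 2),
      pochhammerPair_eq_prod]
  rw [Fintype.prod_sigma, Fin.prod_univ_two]
  refine (congrArg₂ (· * ·) upper_row lower_row).trans ?_
  rw [pochhammerPair_add]
  ring

theorem signedOkounkov_two_rows {τ : ℝ} (hτ : 0 < τ) (α : ℝ) (l m : ℕ) (x : Fin 2 → ℝ) :
    signedOkounkov τ α ![l + m, l] x =
      pochhammerPair α (x 0) l * pochhammerPair α (x 1) l *
        ∑ p ∈ antidiagonal m,
          Ring.multichoose τ p.1 * Ring.multichoose τ p.2 / Ring.multichoose τ m *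
            (pochhammerPair (α + l) (x 1) p.1 *
              pochhammerPair (τ + α + (l + p.1 : ℕ)) (x 0) p.2) := by
  classical
  rw [signedOkounkov_eq_sum, mul_sum]
  symm
  refine sum_bij (fun p _ => twoRowTableau l m p.1) (fun p _ => ?_) ?_ ?_ ?_
  · exact mem_filter.2 ⟨mem_univ _, isReverseTableau_twoRowTableau l m p.1⟩
  · intro p hp r hr heq
    exact (HasAntidiagonal.antidiagonal_congr hp hr).2 <|
      twoRowTableau_injOn l m (HasAntidiagonal.antidiagonal.fst_le hp)
        (HasAntidiagonal.antidiagonal.fst_le hr) heq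
  · intro T hT
    obtain ⟨i, hi, rfl⟩ := (mem_filter.1 hT).2.exists_eq_twoRowTableau
    exact ⟨(i, m - i), mem_antidiagonal.2 (Nat.add_sub_of_le hi), rfl⟩
  · rintro ⟨i, k⟩ hp
    obtain rfl : i + k = m := mem_antidiagonal.1 hp
    rw [tableauWeight_twoRowTableau hτ, prod_boxFactor_twoRowTableau, mul_left_comm]

theorem isPartition_pair (l m : ℕ) : IsPartition ![l + m, l] := by
  refine antitone_iff_forall_lt.2 fun i j hij => ?_
  fin_cases i <;> fin_cases j <;> simp at hij ⊢

theorem IsPartition.exists_eq_pair {lam : Fin 2 → ℕ} (h : IsPartition lam) :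
    ∃ l m, lam = ![l + m, l] := by
  obtain ⟨m, hm⟩ := Nat.exists_eq_add_of_le (h (Fin.zero_le 1))
  exact ⟨lam 1, m, by rw [← hm]; exact List.ofFn_inj.1 rfl⟩

end TwoRows

section NonnegativityLoci

/-- The set `𝒜₀` for arbitrary parameters: the points of the Weyl chamber at which all the signed
Okounkov polynomials are nonnegative. -/
def nonnegLocus (n : ℕ) (τ α : ℝ) : Set (Fin n → ℝ) :=
  {x | x ∈ chamber n ∧ ∀ lam : Fin n → ℕ, IsPartition lam → 0 ≤ signedOkounkov τ α lam x}

/-- The part of the Weyl chamber cut out by the polynomials of the two column shapes `(1)` and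
`(1, 1)`, where the series `R` is considered. -/
def columnRegion (τ α : ℝ) : Set (Fin 2 → ℝ) :=
  {x | x ∈ chamber 2 ∧ 0 ≤ signedOkounkov τ α ![1, 0] x ∧ 0 ≤ signedOkounkov τ α ![1, 1] x}

/-- The terms of the series `R` for arbitrary parameters, with `ρ = (τ + α, α)`. -/
noncomputable def rSeriesTerm (τ α : ℝ) (x : Fin 2 → ℝ) : ℕ → ℝ :=
  hypergeometricTerm [α + x 1, α - x 1, τ] [τ + α + x 0, τ + α - x 0]

/-- The set `ℬ` for arbitrary parameters. -/
def hypergeometricLocus (τ α : ℝ) : Set (Fin 2 → ℝ) :=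
  {x | x ∈ chamber 2 ∧ 0 ≤ signedOkounkov τ α ![1, 0] x ∧ 0 ≤ signedOkounkov τ α ![1, 1] x ∧
    0 ≤ ∑' k, rSeriesTerm τ α x k}

variable {τ α : ℝ} {x : Fin 2 → ℝ}

theorem signedOkounkov_one_zero (hτ : 0 < τ) (α : ℝ) (x : Fin 2 → ℝ) :
    signedOkounkov τ α ![1, 0] x = α ^ 2 - x 1 ^ 2 + ((τ + α) ^ 2 - x 0 ^ 2) := by
  have h := signedOkounkov_two_rows hτ α 0 1 x
  simpa only [Nat.sum_antidiagonal_succ, Nat.antidiagonal_zero, sum_singleton, zero_add, add_zero,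
    Nat.cast_zero, Ring.multichoose_zero_right, Ring.multichoose_one_right, pochhammerPair_zero,
    pochhammerPair_one, one_mul, mul_one, div_self hτ.ne', add_comm ((τ + α) ^ 2 - _)] using h

theorem signedOkounkov_one_one (hτ : 0 < τ) (α : ℝ) (x : Fin 2 → ℝ) :
    signedOkounkov τ α ![1, 1] x = (α ^ 2 - x 0 ^ 2) * (α ^ 2 - x 1 ^ 2) := by
  have h := signedOkounkov_two_rows hτ α 1 0 x
  simpa only [add_zero, Nat.antidiagonal_zero, sum_singleton, Ring.multichoose_zero_right,
    pochhammerPair_zero, pochhammerPair_one, one_mul, mul_one, div_one] using h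

section ColumnRegion

variable (hτ : 0 < τ) (hα : 0 ≤ α) (hx : x ∈ columnRegion τ α)

include hτ hα hx

theorem apply_zero_lt_of_mem_columnRegion (h : α < x 1) : x 0 < τ + α := by
  obtain ⟨-, h10, -⟩ := hx
  rw [signedOkounkov_one_zero hτ] at h10
  have hsq : α ^ 2 < x 1 ^ 2 := by gcongr
  exact lt_of_pow_lt_pow_left₀ 2 (by positivity) (by linarith)

theorem pochhammerPair_pos_of_mem_columnRegion (h : α < x 1) (k : ℕ) :
    0 < pochhammerPair (τ + α) (x 0) k :=
  pochhammerPair_pos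
    ((abs_of_nonneg (hx.1.2 0)).trans_lt (apply_zero_lt_of_mem_columnRegion hτ hα hx h)) k

theorem apply_zero_le_of_mem_columnRegion : x 0 ≤ τ + α := by
  obtain ⟨-, h10, h11⟩ := hx
  rw [signedOkounkov_one_zero hτ] at h10
  rw [signedOkounkov_one_one hτ] at h11
  rcases le_or_gt (x 0) α with h0 | h0
  · linarith
  · have hsq : α ^ 2 < x 0 ^ 2 := by gcongr
    have h1 : α ^ 2 - x 1 ^ 2 ≤ 0 := nonpos_of_mul_nonneg_right h11 (by linarith)
    exact le_of_sq_le_sq (by linarith) (by positivity)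

theorem abs_apply_zero_le_of_mem_columnRegion : |x 0| ≤ τ + α :=
  (abs_of_nonneg (hx.1.2 0)).trans_le (apply_zero_le_of_mem_columnRegion hτ hα hx)

theorem apply_one_eq_of_mem_columnRegion (h : x 0 = τ + α) : x 1 = α := by
  obtain ⟨⟨-, hpos⟩, h10, h11⟩ := hx
  rw [signedOkounkov_one_zero hτ, h] at h10
  rw [signedOkounkov_one_one hτ, h] at h11
  have hsq : α ^ 2 < (τ + α) ^ 2 := by
    gcongr
    linarith
  have h1 : α ^ 2 - x 1 ^ 2 ≤ 0 := nonpos_of_mul_nonneg_right h11 (by linarith)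
  exact (pow_left_inj₀ (hpos 1) hα two_ne_zero).1 (by linarith)

theorem pochhammerPair_eq_zero_of_mem_columnRegion {k : ℕ}
    (hk : pochhammerPair (τ + α) (x 0) k = 0) : pochhammerPair α (x 1) k = 0 := by
  have h0 : x 0 = τ + α := by
    by_contra hne
    refine (pochhammerPair_pos ?_ k).ne' hk
    rw [abs_of_nonneg (hx.1.2 0)]
    exact lt_of_le_of_ne (apply_zero_le_of_mem_columnRegion hτ hα hx) hne
  cases k with
  | zero => exact absurd hk (by simp [pochhammerPair_zero])
  | succ k =>
    rw [pochhammerPair_succ', apply_one_eq_of_mem_columnRegion hτ hα hx h0, sub_self, zero_mul]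

theorem pochhammerPair_mul_nonneg_of_mem_columnRegion (hτ1 : τ ≤ 1) (l : ℕ) :
    0 ≤ pochhammerPair α (x 0) l * pochhammerPair α (x 1) l := by
  have h0 : x 0 ≤ α + 1 := (apply_zero_le_of_mem_columnRegion hτ hα hx).trans (by linarith)
  obtain ⟨⟨hanti, hpos⟩, -, h11⟩ := hx
  have h1 : x 1 ≤ α + 1 := (hanti (Fin.zero_le 1)).trans h0
  rw [signedOkounkov_one_one hτ] at h11
  cases l with
  | zero => simp only [pochhammerPair_zero, mul_one, zero_le_one]
  | succ l =>
    rw [pochhammerPair_succ', pochhammerPair_succ', mul_mul_mul_comm]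
    exact mul_nonneg h11 (mul_nonneg
      (pochhammerPair_nonneg ((abs_of_nonneg (hpos 0)).trans_le h0) l)
      (pochhammerPair_nonneg ((abs_of_nonneg (hpos 1)).trans_le h1) l))

theorem signedOkounkov_nonneg_of_mem_columnRegion (hτ1 : τ ≤ 1) {l : ℕ} (h1 : x 1 ≤ α + l)
    (m : ℕ) : 0 ≤ signedOkounkov τ α ![l + m, l] x := by
  have h0 := abs_apply_zero_le_of_mem_columnRegion hτ hα hx
  rw [signedOkounkov_two_rows hτ]
  refine mul_nonneg (pochhammerPair_mul_nonneg_of_mem_columnRegion hτ hα hx hτ1 l)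
    (sum_nonneg fun p _ => mul_nonneg ?_ (mul_nonneg ?_ ?_))
  · exact div_nonneg (mul_nonneg (multichoose_pos hτ _).le (multichoose_pos hτ _).le)
      (multichoose_pos hτ _).le
  · exact pochhammerPair_nonneg ((abs_of_nonneg (hx.1.2 1)).trans_le h1) _
  · exact pochhammerPair_nonneg (h0.trans (le_add_of_nonneg_right (Nat.cast_nonneg _))) _

end ColumnRegion

theorem summable_rSeriesTerm (hτ : 0 < τ) (α : ℝ) (x : Fin 2 → ℝ) :
    Summable (rSeriesTerm τ α x) := by
  refine summable_hypergeometricTerm rfl ?_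
  simp only [List.sum_cons, List.sum_nil]
  linarith

theorem rSeriesTerm_eq (τ α : ℝ) (x : Fin 2 → ℝ) (k : ℕ) :
    rSeriesTerm τ α x k =
      Ring.multichoose τ k * (pochhammerPair α (x 1) k / pochhammerPair (τ + α) (x 0) k) := by
  simp only [rSeriesTerm, hypergeometricTerm, List.map_cons, List.map_nil, List.prod_cons,
    List.prod_nil, multichoose_eq_ascPochhammer_eval_div, pochhammerPair, mul_one]
  ring

theorem rSeriesTerm_nonneg (hτ : 0 < τ) (h0 : |x 0| ≤ τ + α) (h1 : |x 1| ≤ α) (k : ℕ) :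
    0 ≤ rSeriesTerm τ α x k := by
  rw [rSeriesTerm_eq]
  exact mul_nonneg (multichoose_pos hτ k).le
    (div_nonneg (pochhammerPair_nonneg h1 k) (pochhammerPair_nonneg h0 k))

theorem rSeriesTerm_succ_nonpos (hτ : 0 < τ) (h0 : |x 0| ≤ τ + α) (hα1 : |α| ≤ |x 1|)
    (h1 : |x 1| ≤ α + 1) (k : ℕ) : rSeriesTerm τ α x (k + 1) ≤ 0 := by
  rw [rSeriesTerm_eq]
  exact mul_nonpos_of_nonneg_of_nonpos (multichoose_pos hτ _).le
    (div_nonpos_of_nonpos_of_nonneg (pochhammerPair_succ_nonpos hα1 h1 k)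
      (pochhammerPair_nonneg h0 _))

theorem signedOkounkov_one_row (hτ : 0 < τ) {m : ℕ} (hm : pochhammerPair (τ + α) (x 0) m ≠ 0) :
    signedOkounkov τ α ![m, 0] x = pochhammerPair (τ + α) (x 0) m *
      ∑ p ∈ antidiagonal m,
        Ring.multichoose τ p.2 / Ring.multichoose τ m * rSeriesTerm τ α x p.1 := by
  have h := signedOkounkov_two_rows hτ α 0 m x
  simp only [zero_add, pochhammerPair_zero, Nat.cast_zero, add_zero, one_mul] at h
  rw [h, mul_sum]
  refine sum_congr rfl ?_
  rintro ⟨i, k⟩ hp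
  obtain rfl : i + k = m := mem_antidiagonal.1 hp
  rw [pochhammerPair_add] at hm
  have hi := left_ne_zero_of_mul hm
  have hmc := (multichoose_pos hτ (i + k)).ne'
  rw [rSeriesTerm_eq, pochhammerPair_add]
  field_simp

theorem weighted_sum_rSeriesTerm_le (hτ : 0 < τ) (hτ1 : τ ≤ 1)
    (hneg : ∀ k, rSeriesTerm τ α x (k + 1) ≤ 0) (m : ℕ) :
    ∑ p ∈ antidiagonal m, Ring.multichoose τ p.2 / Ring.multichoose τ m * rSeriesTerm τ α x p.1 ≤
      ∑ k ∈ range (m + 1), rSeriesTerm τ α x k := by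
  have hmc := multichoose_pos hτ m
  rw [Nat.sum_antidiagonal_eq_sum_range_succ (fun i k =>
    Ring.multichoose τ k / Ring.multichoose τ m * rSeriesTerm τ α x i)]
  refine sum_le_sum fun k _ => ?_
  cases k with
  | zero => rw [Nat.sub_zero, div_self hmc.ne', one_mul]
  | succ k =>
    refine mul_le_of_one_le_left (hneg k) ((one_le_div hmc).2 ?_)
    exact antitone_multichoose hτ hτ1 (Nat.sub_le m (k + 1))

theorem tsum_rSeriesTerm_le_sum_range (hτ : 0 < τ) (hneg : ∀ k, rSeriesTerm τ α x (k + 1) ≤ 0)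
    (m : ℕ) : ∑' k, rSeriesTerm τ α x k ≤ ∑ k ∈ range (m + 1), rSeriesTerm τ α x k := by
  rw [← (summable_rSeriesTerm hτ α x).sum_add_tsum_nat_add (m + 1)]
  exact add_le_of_nonpos_right (tsum_nonpos fun k => hneg (k + m))

theorem rSeriesTerm_succ_nonpos_of_mem_columnRegion (hτ : 0 < τ) (hτ1 : τ ≤ 1) (hα : 0 ≤ α)
    (hx : x ∈ columnRegion τ α) (h1 : α < x 1) (k : ℕ) : rSeriesTerm τ α x (k + 1) ≤ 0 := by
  have h0 := apply_zero_le_of_mem_columnRegion hτ hα hx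
  obtain ⟨hanti, hpos⟩ := hx.1
  refine rSeriesTerm_succ_nonpos hτ (abs_apply_zero_le_of_mem_columnRegion hτ hα hx) ?_ ?_ k
  · exact abs_le_abs_of_nonneg hα h1.le
  · rw [abs_of_nonneg (hpos 1)]
    linarith [hanti (Fin.zero_le 1)]

theorem nonnegLocus_subset_hypergeometricLocus (hτ : 0 < τ) (hτ1 : τ ≤ 1) (hα : 0 ≤ α) :
    nonnegLocus 2 τ α ⊆ hypergeometricLocus τ α := by
  rintro x ⟨hx, hq⟩
  have h10 : 0 ≤ signedOkounkov τ α ![1, 0] x := hq _ (isPartition_pair 0 1)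
  have h11 : 0 ≤ signedOkounkov τ α ![1, 1] x := hq _ (isPartition_pair 1 0)
  have hreg : x ∈ columnRegion τ α := ⟨hx, h10, h11⟩
  refine ⟨hx, h10, h11, ?_⟩
  rcases le_or_gt (x 1) α with h1 | h1
  · exact tsum_nonneg (rSeriesTerm_nonneg hτ (abs_apply_zero_le_of_mem_columnRegion hτ hα hreg)
      ((abs_of_nonneg (hx.2 1)).trans_le h1))
  · have hpos := pochhammerPair_pos_of_mem_columnRegion hτ hα hreg h1
    have hneg := rSeriesTerm_succ_nonpos_of_mem_columnRegion hτ hτ1 hα hreg h1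
    have partial_sums := (tendsto_add_atTop_iff_nat 1).2
      (summable_rSeriesTerm hτ α x).hasSum.tendsto_sum_nat
    refine ge_of_tendsto' partial_sums fun m => ?_
    have hrow : 0 ≤ signedOkounkov τ α ![m, 0] x := by simpa using hq _ (isPartition_pair 0 m)
    rw [signedOkounkov_one_row hτ (hpos m).ne'] at hrow
    exact (nonneg_of_mul_nonneg_right hrow (hpos m)).trans
      (weighted_sum_rSeriesTerm_le hτ hτ1 hneg m)

theorem hypergeometricLocus_one_subset_nonnegLocus (hα : 0 ≤ α) :
    hypergeometricLocus 1 α ⊆ nonnegLocus 2 1 α := by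
  rintro x ⟨hx, h10, h11, hR⟩
  have hreg : x ∈ columnRegion 1 α := ⟨hx, h10, h11⟩
  refine ⟨hx, fun lam hlam => ?_⟩
  obtain ⟨l, m, rfl⟩ := hlam.exists_eq_pair
  rcases le_or_gt (x 1) (α + l) with h1 | h1
  · exact signedOkounkov_nonneg_of_mem_columnRegion one_pos hα hreg le_rfl h1 m
  have hα1 : α < x 1 := (le_add_of_nonneg_right l.cast_nonneg).trans_lt h1
  obtain rfl : l = 0 := by
    have hl : (l : ℝ) < 1 := by
      linarith [hx.1 (Fin.zero_le 1), apply_zero_lt_of_mem_columnRegion one_pos hα hreg hα1]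
    exact Nat.lt_one_iff.1 (by exact_mod_cast hl)
  have hpos := pochhammerPair_pos_of_mem_columnRegion one_pos hα hreg hα1 m
  rw [zero_add, signedOkounkov_one_row one_pos hpos.ne']
  refine mul_nonneg hpos.le ?_
  simp only [Ring.multichoose_one, div_one, one_mul]
  rw [Nat.sum_antidiagonal_eq_sum_range_succ (fun i _ => rSeriesTerm 1 α x i)]
  exact hR.trans (tsum_rSeriesTerm_le_sum_range one_pos
    (rSeriesTerm_succ_nonpos_of_mem_columnRegion one_pos le_rfl hα hreg hα1) m)

end NonnegativityLoci

namespace RankTwoDomain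

theorem tau_pos (D : RankTwoDomain) : 0 < D.tau := by
  cases D <;> norm_num [tau, d]

theorem tau_le_one (D : RankTwoDomain) : D.tau ≤ 1 := by
  cases D <;> norm_num [tau, d]

theorem tau_typeI (b : ℕ) : (typeI b).tau = 1 := by
  norm_num [tau, d]

theorem alpha_nonneg (D : RankTwoDomain) : 0 ≤ D.alpha := by
  rw [alpha]
  positivity

end RankTwoDomain

end Shimura

open Shimura in
theorem theorem5_general {τ α : ℝ} (hτ : 0 < τ) (hτ1 : τ ≤ 1) (hα : 0 ≤ α) :
    (∀ x, (∀ k, pochhammerPair (τ + α) (x 0) k = 0 → pochhammerPair α (x 1) k = 0) →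
      Summable (rSeriesTerm τ α x)) ∧
    nonnegLocus 2 τ α ⊆ hypergeometricLocus τ α ∧
    (τ = 1 → nonnegLocus 2 τ α = hypergeometricLocus τ α) := by
  refine ⟨fun x _ => summable_rSeriesTerm hτ α x,
    nonnegLocus_subset_hypergeometricLocus hτ hτ1 hα, ?_⟩
  rintro rfl
  exact (nonnegLocus_subset_hypergeometricLocus hτ hτ1 hα).antisymm
    (hypergeometricLocus_one_subset_nonnegLocus hα)

/-- The series `R` converges wherever it is used; `𝒜₀ = ℬ` for type `I_{2,2+b}`; `𝒜₀ ⊆ ℬ` for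
type `II_2`. -/
theorem theorem5 :
    (∀ (D : Shimura.RankTwoDomain) (x : Fin 2 → ℝ), x ∈ Shimura.chamber 2 →
      0 ≤ D.q ![1, 0] x → 0 ≤ D.q ![1, 1] x → Summable (D.rTerm x)) ∧
    (∀ b : ℕ, (Shimura.RankTwoDomain.typeI b).A0 = (Shimura.RankTwoDomain.typeI b).B) ∧
    Shimura.RankTwoDomain.typeII.A0 ⊆ Shimura.RankTwoDomain.typeII.B := by
  have general (D : Shimura.RankTwoDomain) :=
    theorem5_general D.tau_pos D.tau_le_one D.alpha_nonneg
  exact ⟨fun D x hx h10 h11 => (general D).1 x fun _ =>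
      Shimura.pochhammerPair_eq_zero_of_mem_columnRegion D.tau_pos D.alpha_nonneg ⟨hx, h10, h11⟩,
    fun b => (general (.typeI b)).2.2 (Shimura.RankTwoDomain.tau_typeI b), (general .typeII).2.1⟩
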